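/- Let $\mathfrak{sl}_2$ be the complex Lie algebra of traceless $2\times 2$ matrices with standard basis $E=\begin{pmatrix}0&1\\0&0\end{pmatrix}$, $H=\begin{pmatrix}1&0\\0&-1\end{pmatrix}$, $F=\begin{pmatrix}0&0\\1&0\end{pmatrix}$ and invariant form $(X|Y)=\operatorname{tr}(XY)$, and let $\widehat{\mathfrak{sl}}_2=\mathfrak{sl}_2\otimes\mathbb{C}[\zeta,\zeta^{-1}]\oplus\mathbb{C}K$ be the affine Lie algebra, with $X(n)=X\otimes\zeta^n$, $[X(m),Y(n)]=[X,Y](m+n)+m\,(X|Y)\,\delta_{m+n,0}K$ and $K$ central. Let $\Lambda$ be the fundamental weight of $\mathfrak{sl}_2$ and let $L(\Lambda)=\mathbb{C}v_\Lambda\oplus\mathbb{C}Fv_\Lambda$ be the fundamental representation, where $v_\Lambda\neq 0$ is a highest weight vector ($Ev_\Lambda=0$, $Hv_\Lambda=v_\Lambda$); put $v_{-\Lambda}=Fv_\Lambda$. Let $\widehat{L(\Lambda)}_1=U(\widehat{\mathfrak{sl}}_2)\otimes_{U(\mathfrak{sl}_2\otimes\mathbb{C}[\zeta]\oplus\mathbb{C}K)}L(\Lambda)$,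 where $X(0)$ acts on $L(\Lambda)$ as $X$, $X(n)$ acts as $0$ for $n>0$, and $K$ acts as $1$; let $L_{\mathfrak{sl}_2}(\Lambda,1)$ be the irreducible quotient of $\widehat{L(\Lambda)}_1$, and regard $v_{\pm\Lambda}$ as vectors of it. Let $X_1,X_2,X_3$ be an orthonormal basis of $\mathfrak{sl}_2$ with respect to $(\cdot|\cdot)$, and let $$L_n=\frac{1}{2(1+2)}\sum_{r=1}^{3}\sum_{j\in\mathbb{Z}}{:}X_r(n-j)X_r(j){:}\qquad(n\in\mathbb{Z})$$ be the Segal–Sugawara operators on $L_{\mathfrak{sl}_2}(\Lambda,1)$, where ${:}A(p)B(q){:}$ is $A(p)B(q)$ for $p<q$ and $B(q)A(p)$ for $p\ge q$ (on each vector only finitely many terms are nonzero). Let $\kappa,\tau\in\mathbb{C}$ satisfy $\kappa+2\tau-4=0$. Then in $L_{\mathfrak{sl}_2}(\Lambda,1)$ $$\Bigl(-2L_{-2}+\frac{\kappa}{2}L_{-1}^2+\frac{\tau}{2}\sum_{r=1}^{3}X_r(-1)^2\Bigr)v_{\pm\Lambda}=0 .$$ -/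

import Mathlib

namespace AffineSl2

noncomputable section

open scoped TensorProduct

/-- The complex Lie algebra `sl₂` of traceless `2 × 2` matrices. -/
abbrev sl2 : Type := LieAlgebra.SpecialLinear.sl (Fin 2) ℂ

/-- `E = (0 1; 0 0)`. -/
def E : sl2 := LieAlgebra.SpecialLinear.single 0 1 (by decide) 1

/-- `F = (0 0; 1 0)`. -/
def F : sl2 := LieAlgebra.SpecialLinear.single 1 0 (by decide) 1

/-- `H = (1 0; 0 -1)`. -/
def H : sl2 := LieAlgebra.SpecialLinear.singleSubSingle 0 1 1

/-- The invariant form `(X|Y) = tr (X Y)` on `sl₂`, the trace form of the natural representation.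
It is the one normalized by `(θ|θ) = 2` for the highest root `θ` (equivalently, `(H|H) = 2`). -/
def form : LinearMap.BilinForm ℂ sl2 := LieModule.traceForm ℂ sl2 (Fin 2 → ℂ)

theorem form_apply (X Y : sl2) : form X Y = (X.1 * Y.1).trace := by
  have h : LieModule.toEnd ℂ sl2 (Fin 2 → ℂ) X ∘ₗ LieModule.toEnd ℂ sl2 (Fin 2 → ℂ) Y
      = Matrix.toLin' (X.1 * Y.1) := by
    ext v : 1
    rw [Matrix.toLin'_mul]
    rfl
  rw [form, LieModule.traceForm_apply_apply, h, Matrix.trace_toLin'_eq]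

/-- The loop algebra `sl₂ ⊗ ℂ[ζ, ζ⁻¹]`. -/
abbrev Loop : Type := LieAlgebra.loopAlgebra ℂ ℤ sl2

/-- The 2-cocycle with `(X ⊗ ζᵐ, Y ⊗ ζⁿ) ↦ m (X|Y) δ_{m+n,0}`. It is the one that Mathlib attaches
to the form `-(·|·)`, since the cocycle of a form `Φ` there is `(f, g) ↦ Res Φ(f, dg)`, which is
`n Φ(X, Y) δ_{m+n,0}` on such a pair. -/
def cocycle : LieModule.Cohomology.twoCocycle ℂ Loop (TrivialLieModule ℂ Loop ℂ) :=
  LieAlgebra.LoopAlgebra.twoCocycleOfBilinear ℂ ℤ sl2 (-form)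
    (fun x y z => by
      simp only [LinearMap.neg_apply]
      rw [form, LieModule.traceForm_lieInvariant ℂ sl2 (Fin 2 → ℂ) x y z])
    ⟨fun x y => by
      simp only [LinearMap.neg_apply]
      rw [form, LieModule.traceForm_comm ℂ sl2 (Fin 2 → ℂ) x y]⟩

/-- The affine Lie algebra `sl₂ ⊗ ℂ[ζ, ζ⁻¹] ⊕ ℂ K`. -/
abbrev Affine : Type := LieAlgebra.ofTwoCocycle cocycle

/-- `X(n) = X ⊗ ζⁿ`. -/
def loopElt (X : sl2) (n : ℤ) : Affine :=
  LieAlgebra.ofProd cocycle (AddMonoidAlgebra.single n 1 ⊗ₜ[ℂ] X, 0)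

/-- The central element `K`. -/
def central : Affine :=
  LieAlgebra.ofProd cocycle (0, (TrivialLieModule.equiv ℂ Loop ℂ).symm 1)

theorem cocycle_apply (X Y : sl2) (m n : ℤ) :
    cocycle.1.1 (AddMonoidAlgebra.single m 1 ⊗ₜ[ℂ] X) (AddMonoidAlgebra.single n 1 ⊗ₜ[ℂ] Y)
      = (TrivialLieModule.equiv ℂ Loop ℂ).symm
        (if m + n = 0 then (m : ℂ) * form X Y else 0) := by
  change (TrivialLieModule.equiv ℂ Loop ℂ).symm (LieAlgebra.LoopAlgebra.residuePairing ℂ ℤ sl2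
    (-form) (AddMonoidAlgebra.single m 1 ⊗ₜ[ℂ] X) (AddMonoidAlgebra.single n 1 ⊗ₜ[ℂ] Y)) = _
  congr 1
  rw [LieAlgebra.LoopAlgebra.residuePairing_apply_apply,
    LieAlgebra.LoopAlgebra.toFinsupp_single_tmul, LieAlgebra.LoopAlgebra.toFinsupp_single_tmul,
    Finsupp.sum_single_index (by simp)]
  by_cases h : m + n = 0
  · obtain rfl : n = -m := by omega
    rw [neg_neg, Finsupp.single_eq_same, if_pos h]
    simp
  · rw [Finsupp.single_eq_of_ne (by omega), if_neg h]
    simp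

/-- The bracket `[X(m), Y(n)] = [X, Y](m + n) + m (X|Y) δ_{m+n,0} K`. -/
theorem loopElt_lie (X Y : sl2) (m n : ℤ) :
    ⁅loopElt X m, loopElt Y n⁆
      = loopElt ⁅X, Y⁆ (m + n) + (if m + n = 0 then (m : ℂ) * form X Y else 0) • central := by
  rw [LieAlgebra.bracket_ofTwoCocycle]
  simp only [loopElt, central, Equiv.symm_apply_apply, ← LieAlgebra.of_smul, ← LieAlgebra.of_add]
  congr 1
  refine Prod.ext ?_ ?_
  · change ⁅(AddMonoidAlgebra.single m 1 : AddMonoidAlgebra ℂ ℤ) ⊗ₜ[ℂ] X,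
      (AddMonoidAlgebra.single n 1 : AddMonoidAlgebra ℂ ℤ) ⊗ₜ[ℂ] Y⁆
        = AddMonoidAlgebra.single (m + n) 1 ⊗ₜ[ℂ] ⁅X, Y⁆ + _ • (0 : Loop)
    rw [smul_zero, add_zero, LieAlgebra.ExtendScalars.bracket_tmul,
      AddMonoidAlgebra.single_mul_single, mul_one]
  · have h := cocycle_apply X Y m n
    rw [← mul_one (if m + n = 0 then (m : ℂ) * form X Y else 0), ← smul_eq_mul, map_smul] at h
    simp only [Prod.snd_add, Prod.smul_snd, lie_zero, add_zero, sub_zero, zero_add]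
    exact h

theorem central_lie (x : Affine) : ⁅central, x⁆ = 0 := by
  rw [LieAlgebra.bracket_ofTwoCocycle]
  simp only [central, Equiv.symm_apply_apply, ← LieAlgebra.of_zero cocycle]
  congr 1
  refine Prod.ext ?_ ?_
  · simp
  · simp [trivial_lie_zero]

/-- The affine Lie algebra is spanned by the `X(n)` and `K`. -/
theorem affine_induction {p : Affine → Prop} (hadd : ∀ x y, p x → p y → p (x + y))
    (hloop : ∀ X n, p (loopElt X n)) (hcentral : ∀ c : ℂ, p (c • central)) (x : Affine) : p x := by
  have hzero : p (LieAlgebra.ofProd cocycle 0) := by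
    have := hcentral 0
    rwa [zero_smul, ← LieAlgebra.of_zero cocycle] at this
  have hfst : ∀ f : Loop, p (LieAlgebra.ofProd cocycle (f, 0)) := by
    intro f
    induction f using TensorProduct.induction_on with
    | zero => exact hzero
    | add f g hf hg =>
      have := hadd _ _ hf hg
      rwa [← LieAlgebra.of_add, Prod.mk_add_mk, add_zero] at this
    | tmul a X =>
      induction a using AddMonoidAlgebra.induction_linear with
      | zero => rw [TensorProduct.zero_tmul]; exact hzero
      | add a b ha hb =>
        have := hadd _ _ ha hb
        rwa [← LieAlgebra.of_add, Prod.mk_add_mk, add_zero, ← TensorProduct.add_tmul] at this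
      | single n c =>
        have h : (AddMonoidAlgebra.single n c : AddMonoidAlgebra ℂ ℤ) ⊗ₜ[ℂ] X
            = AddMonoidAlgebra.single n 1 ⊗ₜ[ℂ] (c • X) := by
          rw [TensorProduct.tmul_smul, TensorProduct.smul_tmul', AddMonoidAlgebra.smul_single,
            smul_eq_mul, mul_one]
        rw [h]
        exact hloop (c • X) n
  obtain ⟨⟨f, c⟩, rfl⟩ := (LieAlgebra.ofProd cocycle).surjective x
  have := hadd _ _ (hfst f) (hcentral (TrivialLieModule.equiv ℂ Loop ℂ c))
  rw [central, ← LieAlgebra.of_smul, ← LieAlgebra.of_add, Prod.smul_mk, smul_zero, Prod.mk_add_mk,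
    add_zero, zero_add, ← map_smul, smul_eq_mul, mul_one, LinearEquiv.symm_apply_apply] at this
  exact this

/-- The universal enveloping algebra of the affine Lie algebra. Representations of the affine Lie
algebra are treated as modules over it. -/
abbrev U : Type := UniversalEnvelopingAlgebra ℂ Affine

/-- `X(n)` in the universal enveloping algebra. -/
def mode (X : sl2) (n : ℤ) : U := UniversalEnvelopingAlgebra.ι ℂ (loopElt X n)

/-- `K` in the universal enveloping algebra. -/
def modeK : U := UniversalEnvelopingAlgebra.ι ℂ central

section

attribute [local instance 100] LieRing.ofAssociativeRing

theorem ι_smul_central (c : ℂ) : UniversalEnvelopingAlgebra.ι ℂ (c • central) = c • modeK :=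
  map_smul (UniversalEnvelopingAlgebra.ι ℂ) c central

theorem mode_mul_mode (X Y : sl2) (m n : ℤ) :
    mode X m * mode Y n = mode Y n * mode X m + mode ⁅X, Y⁆ (m + n)
      + (if m + n = 0 then (m : ℂ) * form X Y else 0) • modeK := by
  have h := congrArg (UniversalEnvelopingAlgebra.ι ℂ) (loopElt_lie X Y m n)
  rw [LieHom.map_lie, map_add, ι_smul_central, LieRing.of_associative_ring_bracket, sub_eq_iff_eq_add] at h
  change mode X m * mode Y n = mode ⁅X, Y⁆ (m + n) + _ + mode Y n * mode X m at h
  rw [h]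
  abel

theorem mode_mul_modeK (X : sl2) (n : ℤ) : mode X n * modeK = modeK * mode X n := by
  have h := congrArg (UniversalEnvelopingAlgebra.ι ℂ) (central_lie (loopElt X n))
  rw [LieHom.map_lie, map_zero, LieRing.of_associative_ring_bracket, sub_eq_zero] at h
  exact h.symm

end

section Induced

variable (M : Type*) [AddCommGroup M] [Module ℂ M] [LieRingModule sl2 M]

/-- The relations which turn `U ⊗_ℂ M` into `U ⊗_{U(𝔟)} M` for `𝔟 = sl₂ ⊗ ℂ[ζ] ⊕ ℂ K`, where
`X(0)` acts on `M` as `X`, `X(n)` acts as zero for `n > 0`, and `K` acts as `k`. As `𝔟` is spanned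
by the `X(n)` with `n ≥ 0` and by `K`, these generate all relations `u b ⊗ m = u ⊗ b m`. -/
def inducedRel (k : ℂ) : Submodule U (U ⊗[ℂ] M) :=
  Submodule.span U
    ({x | ∃ (X : sl2) (m : M), x = mode X 0 ⊗ₜ[ℂ] m - 1 ⊗ₜ[ℂ] ⁅X, m⁆} ∪
      {x | ∃ (X : sl2) (n : ℤ) (m : M), 0 < n ∧ x = mode X n ⊗ₜ[ℂ] m} ∪
      {x | ∃ m : M, x = modeK ⊗ₜ[ℂ] m - 1 ⊗ₜ[ℂ] (k • m)})

/-- The representation of level `k` induced from `M`. -/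
def Induced (k : ℂ) : Type _ := (U ⊗[ℂ] M) ⧸ inducedRel M k

instance (k : ℂ) : AddCommGroup (Induced M k) :=
  inferInstanceAs (AddCommGroup ((U ⊗[ℂ] M) ⧸ inducedRel M k))

instance (k : ℂ) : Module U (Induced M k) :=
  inferInstanceAs (Module U ((U ⊗[ℂ] M) ⧸ inducedRel M k))

instance (k : ℂ) : Module ℂ (Induced M k) :=
  inferInstanceAs (Module ℂ ((U ⊗[ℂ] M) ⧸ inducedRel M k))

instance (k : ℂ) : IsScalarTower ℂ U (Induced M k) :=
  inferInstanceAs (IsScalarTower ℂ U ((U ⊗[ℂ] M) ⧸ inducedRel M k))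

/-- The projection from `U ⊗_ℂ M` onto the induced representation. -/
def proj (k : ℂ) : U ⊗[ℂ] M →ₗ[U] Induced M k := (inducedRel M k).mkQ

theorem proj_eq_zero {k : ℂ} {x : U ⊗[ℂ] M} (hx : x ∈ inducedRel M k) : proj M k x = 0 :=
  (Submodule.Quotient.mk_eq_zero _).2 hx

theorem proj_surjective (k : ℂ) : Function.Surjective (proj M k) :=
  (inducedRel M k).mkQ_surjective

end Induced

/-- A representation is smooth if each of its vectors is annihilated by `X(n)` for all `X` and all
sufficiently large `n`. -/
def IsSmooth (V : Type*) [AddCommGroup V] [Module U V] : Prop :=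
  ∀ w : V, ∃ N : ℤ, ∀ n ≥ N, ∀ X : sl2, mode X n • w = 0

/-- The normally ordered product of `X(p)` and `Y(q)`. -/
def normalOrdered (X Y : sl2) (p q : ℤ) : U :=
  if p < q then mode X p * mode Y q else mode Y q * mode X p

theorem IsSmooth.finite_support {V : Type*} [AddCommGroup V] [Module U V] (hV : IsSmooth V)
    (X Y : sl2) (n : ℤ) (w : V) :
    (Function.support fun j : ℤ => normalOrdered X Y (n - j) j • w).Finite := by
  obtain ⟨N, hN⟩ := hV w
  refine (Set.finite_Icc (-(|n| + |N|)) (|n| + |N|)).subset fun j hj => ?_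
  rw [Function.mem_support, normalOrdered] at hj
  have h1 := neg_abs_le n
  have h2 := neg_abs_le N
  have h3 := le_abs_self n
  have h4 := le_abs_self N
  split_ifs at hj with h
  · have : j < N := by
      by_contra hc
      exact hj (by rw [mul_smul, hN j (by omega), smul_zero])
    constructor <;> omega
  · have : n - j < N := by
      by_contra hc
      exact hj (by rw [mul_smul, hN (n - j) (by omega), smul_zero])
    constructor <;> omega

section Sugawara

variable {V : Type*} [AddCommGroup V] [Module ℂ V] [Module U V] [IsScalarTower ℂ U V]

/-- The operator by which an element of the enveloping algebra acts on a representation. -/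
abbrev act (V : Type*) [AddCommGroup V] [Module ℂ V] [Module U V] [IsScalarTower ℂ U V]
    (u : U) : Module.End ℂ V := Algebra.lsmul ℂ ℂ V u

/-- The operator `∑_{j ∈ ℤ} :X(n - j) Y(j):` on a smooth representation; only finitely many terms
are nonzero on each vector. -/
def normalOrderedSum (hV : IsSmooth V) (X Y : sl2) (n : ℤ) : Module.End ℂ V where
  toFun w := ∑ᶠ j : ℤ, normalOrdered X Y (n - j) j • w
  map_add' w w' := by
    simp only [smul_add]
    exact finsum_add_distrib (hV.finite_support X Y n w) (hV.finite_support X Y n w')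
  map_smul' c w := by
    rw [RingHom.id_apply, smul_finsum]
    exact finsum_congr fun j => ((Algebra.lsmul ℂ ℂ V _).map_smul c w)

/-- The vectors that are annihilated by `X(n)` for all `X` and all sufficiently large `n`. -/
def smoothPart (V : Type*) [AddCommGroup V] [Module ℂ V] [Module U V] [IsScalarTower ℂ U V] :
    Submodule ℂ V where
  carrier := {w | ∃ b : ℤ, ∀ n ≥ b, ∀ X : sl2, mode X n • w = 0}
  zero_mem' := ⟨0, fun n _ X => smul_zero _⟩
  add_mem' := by
    rintro w w' ⟨b, hb⟩ ⟨b', hb'⟩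
    refine ⟨max b b', fun n hn X => ?_⟩
    rw [smul_add, hb n (by omega), hb' n (by omega), add_zero]
  smul_mem' := by
    rintro c w ⟨b, hb⟩
    refine ⟨b, fun n hn X => ?_⟩
    have h : mode X n • c • w = c • mode X n • w := (Algebra.lsmul ℂ ℂ _ (mode X n)).map_smul c w
    rw [h, hb n hn, smul_zero]

theorem ι_smul_mem_smoothPart (x : Affine) :
    ∀ w ∈ smoothPart V, UniversalEnvelopingAlgebra.ι ℂ x • w ∈ smoothPart V := by
  induction x using affine_induction with
  | hadd x y hx hy =>
    intro w hw
    rw [map_add, add_smul]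
    exact add_mem (hx w hw) (hy w hw)
  | hloop Y m =>
    rintro w ⟨b, hb⟩
    refine ⟨max (max b (b - m)) (1 - m), fun n hn X => ?_⟩
    change mode X n • mode Y m • w = 0
    rw [← mul_smul, mode_mul_mode, if_neg (by omega), zero_smul, add_zero, add_smul, mul_smul,
      hb n (by omega), hb (n + m) (by omega), smul_zero, add_zero]
  | hcentral c =>
    rintro w ⟨b, hb⟩
    rw [ι_smul_central, smul_assoc]
    refine Submodule.smul_mem _ c ⟨b, fun n hn X => ?_⟩
    rw [← mul_smul, mode_mul_modeK, mul_smul, hb n hn, smul_zero]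

theorem smul_mem_smoothPart (u : U) : ∀ w ∈ smoothPart V, u • w ∈ smoothPart V := by
  obtain ⟨t, rfl⟩ : ∃ t, UniversalEnvelopingAlgebra.mkAlgHom ℂ Affine t = u :=
    RingCon.mkₐ_surjective _ u
  induction t using TensorAlgebra.induction with
  | algebraMap c =>
    intro w hw
    rw [AlgHom.commutes, algebraMap_smul]
    exact Submodule.smul_mem _ c hw
  | ι x => exact ι_smul_mem_smoothPart x
  | mul a b ha hb =>
    intro w hw
    rw [map_mul, mul_smul]
    exact ha _ (hb w hw)
  | add a b ha hb =>
    intro w hw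
    rw [map_add, add_smul]
    exact add_mem (ha w hw) (hb w hw)

/-- The dual Coxeter number of `sl₂`. -/
def dualCoxeter : ℂ := 2

/-- The Segal–Sugawara operator `L_n = (2 (k + h^∨))⁻¹ ∑_a ∑_j :X_a(n - j) X_a(j):` on a smooth
representation of level `k`, for an orthonormal basis `X_a` of `sl₂`. -/
def sugawara (hV : IsSmooth V) (k : ℂ) (X : Fin 3 → sl2) (n : ℤ) : Module.End ℂ V :=
  (1 / (2 * (k + dualCoxeter))) • ∑ a, normalOrderedSum hV (X a) (X a) n

end Sugawara

section Quotient

variable {M : Type*} [AddCommGroup M] [Module ℂ M] [LieRingModule sl2 M]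
  {k : ℂ}

/-- The vector `m` of `M`, as a vector in the top space of a quotient of the induced
representation. -/
def top (N : Submodule U (Induced M k)) (m : M) : Induced M k ⧸ N :=
  N.mkQ (proj M k (1 ⊗ₜ[ℂ] m))

theorem isSmooth_quotient (N : Submodule U (Induced M k)) : IsSmooth (Induced M k ⧸ N) := by
  have htop : ∀ m : M, top N m ∈ smoothPart (Induced M k ⧸ N) := by
    refine fun m => ⟨1, fun n hn X => ?_⟩
    have h : mode X n • (1 : U) ⊗ₜ[ℂ] m ∈ inducedRel M k := by
      rw [TensorProduct.smul_tmul', smul_eq_mul, mul_one]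
      exact Submodule.subset_span (Or.inl (Or.inr ⟨X, n, m, by omega, rfl⟩))
    rw [top, ← map_smul, ← map_smul, proj_eq_zero M h, map_zero]
  intro w
  obtain ⟨w, rfl⟩ := N.mkQ_surjective w
  obtain ⟨w, rfl⟩ := proj_surjective M k w
  change N.mkQ (proj M k w) ∈ smoothPart (Induced M k ⧸ N)
  induction w using TensorProduct.induction_on with
  | zero => rw [map_zero, map_zero]; exact zero_mem _
  | add x y hx hy => rw [map_add, map_add]; exact add_mem hx hy
  | tmul u m =>
    have h : (u ⊗ₜ[ℂ] m : U ⊗[ℂ] M) = u • ((1 : U) ⊗ₜ[ℂ] m) := by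
      rw [TensorProduct.smul_tmul', smul_eq_mul, mul_one]
    rw [h, map_smul, map_smul]
    exact smul_mem_smoothPart u _ (htop m)

/-- The operator `L_n` on a quotient of the induced representation of level `k`. -/
def virasoro (N : Submodule U (Induced M k)) (X : Fin 3 → sl2) (n : ℤ) :
    Module.End ℂ (Induced M k ⧸ N) :=
  sugawara (isSmooth_quotient N) k X n

end Quotient

end

end AffineSl2

/-!
The commutator `[Y(m), L_n] = m Y(m + n)` of the Segal–Sugawara operators makes `2 L_0 - H(0)/2`
the degree operator of the principal gradation: its eigenvalue on a vector obtained from a singular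
vector by applying modes of the opposite nilradical exceeds the eigenvalue on that vector by the sum
of their degrees. In an irreducible representation a singular vector of positive degree therefore
vanishes, as it would generate a subrepresentation not containing the highest weight vector `v`. At
level one and weight one this applies to `E(-1) v` and `F(0)² v`. The two resulting relations give
`L_{-1}² v = L_{-2} v` and `∑_r X_r(-1)² v = 2 L_{-2} v`, so the operator acts on `v` as
`(κ + 2 τ - 4) / 2` times `L_{-2}`. It commutes with `F(0)`, hence kills `F(0) v` too.
-/

namespace AffineSl2

noncomputable section

open scoped TensorProduct

theorem lie_E_F : ⁅E, F⁆ = H := by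
  apply Subtype.ext
  rw [LieAlgebra.SpecialLinear.sl_bracket]
  ext i j
  fin_cases i <;> fin_cases j <;> simp [E, F, H]

theorem lie_H_E : ⁅H, E⁆ = (2 : ℂ) • E := by
  apply Subtype.ext
  rw [LieAlgebra.SpecialLinear.sl_bracket]
  ext i j
  fin_cases i <;> fin_cases j <;>
    norm_num [E, H, Matrix.mul_apply, Matrix.single_apply]

theorem lie_H_F : ⁅H, F⁆ = (-2 : ℂ) • F := by
  apply Subtype.ext
  rw [LieAlgebra.SpecialLinear.sl_bracket]
  ext i j
  fin_cases i <;> fin_cases j <;>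
    norm_num [F, H, Matrix.mul_apply, Matrix.single_apply]

theorem lie_F_E : ⁅F, E⁆ = (-1 : ℂ) • H := by rw [← lie_skew, lie_E_F, neg_one_smul]

theorem lie_E_H : ⁅E, H⁆ = (-2 : ℂ) • E := by rw [← lie_skew, lie_H_E, neg_smul]

theorem lie_F_H : ⁅F, H⁆ = (2 : ℂ) • F := by rw [← lie_skew, lie_H_F, neg_smul, neg_neg]

theorem apply_one_one (Y : sl2) : Y.1 1 1 = -Y.1 0 0 := by
  have h : Y.1.trace = 0 := Y.2
  rw [Matrix.trace_fin_two] at h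
  linear_combination h

theorem eq_smul_E_add_smul_F_add_smul_H (Y : sl2) :
    Y = Y.1 0 1 • E + Y.1 1 0 • F + Y.1 0 0 • H := by
  have := apply_one_one Y
  apply Subtype.ext
  ext i j
  fin_cases i <;> fin_cases j <;> simp [E, F, H, this]

theorem form_comm (Y Z : sl2) : form Y Z = form Z Y := by
  rw [form_apply, form_apply, Matrix.trace_mul_comm]

theorem form_lie (Y Z W : sl2) : form Z ⁅Y, W⁆ = -form ⁅Y, Z⁆ W := by
  rw [form, ← LieModule.traceForm_apply_lie_apply, ← lie_skew Z Y, map_neg, LinearMap.neg_apply]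

theorem form_lie_self (Y Z : sl2) : form Z ⁅Y, Z⁆ = 0 :=
  self_eq_neg.1 ((form_lie Y Z Z).trans (by rw [form_comm]))

theorem form_eq (Y Z : sl2) :
    form Y Z = 2 * (Y.1 0 0 * Z.1 0 0) + Y.1 0 1 * Z.1 1 0 + Y.1 1 0 * Z.1 0 1 := by
  rw [form_apply, Matrix.trace_fin_two, Matrix.mul_apply, Matrix.mul_apply, Fin.sum_univ_two,
    Fin.sum_univ_two, apply_one_one Y, apply_one_one Z]
  ring

theorem form_E (Y : sl2) : form Y E = Y.1 1 0 := by
  rw [form_eq]; simp [E]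

theorem form_F (Y : sl2) : form Y F = Y.1 0 1 := by
  rw [form_eq]; simp [F]

theorem form_H (Y : sl2) : form Y H = 2 * Y.1 0 0 := by
  rw [form_eq]; simp [H]

theorem form_eq_dual_bases (Y Z : sl2) :
    form Y Z = form Y E * form Z F + form Y F * form Z E + 1 / 2 * (form Y H * form Z H) := by
  rw [form_eq, form_E, form_E, form_F, form_F, form_H, form_H]
  ring

section Orthonormal

variable {X : Module.Basis (Fin 3) ℂ sl2} (hX : ∀ r s, form (X r) (X s) = if r = s then 1 else 0)

include hX

theorem sum_form_smul (Y : sl2) : ∑ r, form (X r) Y • X r = Y := by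
  conv_rhs => rw [← X.sum_repr Y]
  refine Finset.sum_congr rfl fun r _ => ?_
  congr 1
  conv_lhs => rw [← X.sum_repr Y, map_sum]
  simp only [map_smul, hX, smul_eq_mul, mul_ite, mul_one, mul_zero, Finset.sum_ite_eq,
    Finset.mem_univ, if_true]

variable {W : Type*} [AddCommGroup W] [Module ℂ W] (B : sl2 →ₗ[ℂ] sl2 →ₗ[ℂ] W)

theorem map_eq_sum_form_smul (Y Z : sl2) :
    B Y Z = ∑ r, ∑ s, (form (X r) Y * form (X s) Z) • B (X r) (X s) := by
  conv_lhs => rw [← sum_form_smul hX Y, ← sum_form_smul hX Z]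
  simp only [map_sum, LinearMap.sum_apply, map_smul, LinearMap.smul_apply, Finset.smul_sum,
    smul_smul]
  rw [Finset.sum_comm]
  exact Finset.sum_congr rfl fun r _ => Finset.sum_congr rfl fun s _ => by rw [mul_comm]

theorem sum_map_self : ∑ r, B (X r) (X r) = B E F + B F E + (1 / 2 : ℂ) • B H H := by
  rw [map_eq_sum_form_smul hX B E F, map_eq_sum_form_smul hX B F E, map_eq_sum_form_smul hX B H H]
  simp only [Finset.smul_sum, smul_smul, ← Finset.sum_add_distrib, ← add_smul,
    ← form_eq_dual_bases, hX, ite_smul, one_smul, zero_smul, Finset.sum_ite_eq, Finset.mem_univ,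
    if_true]

theorem sum_map_lie (Y : sl2) : ∑ r, B ⁅Y, X r⁆ (X r) = -∑ r, B (X r) ⁅Y, X r⁆ := by
  have hleft : ∑ r, B ⁅Y, X r⁆ (X r) = ∑ r, ∑ s, form (X s) ⁅Y, X r⁆ • B (X s) (X r) := by
    refine Finset.sum_congr rfl fun r _ => ?_
    conv_lhs => rw [← sum_form_smul hX ⁅Y, X r⁆]
    simp only [map_sum, map_smul, LinearMap.sum_apply, LinearMap.smul_apply]
  have hright : ∑ r, B (X r) ⁅Y, X r⁆ = ∑ r, ∑ s, form (X s) ⁅Y, X r⁆ • B (X r) (X s) := by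
    refine Finset.sum_congr rfl fun r _ => ?_
    conv_lhs => rw [← sum_form_smul hX ⁅Y, X r⁆]
    simp only [map_sum, map_smul]
  rw [hleft, hright, Finset.sum_comm]
  simp only [← Finset.sum_neg_distrib]
  refine Finset.sum_congr rfl fun s _ => Finset.sum_congr rfl fun r _ => ?_
  rw [form_lie, form_comm, neg_smul]

theorem sum_lie_lie (Y : sl2) : ∑ r, ⁅⁅Y, X r⁆, X r⁆ = (4 : ℂ) • Y := by
  have hsum := sum_map_self hX
    ((LieAlgebra.ad ℂ sl2 : sl2 →ₗ[ℂ] Module.End ℂ sl2) ∘ₗ LieAlgebra.ad ℂ sl2 Y)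
  simp only [LinearMap.comp_apply, LieHom.coe_toLinearMap, LieAlgebra.ad_apply] at hsum
  rw [hsum, eq_smul_E_add_smul_F_add_smul_H Y]
  simp only [add_lie, smul_lie, zero_lie, lie_self, lie_E_F, lie_F_E, lie_H_E, lie_H_F, lie_E_H,
    lie_F_H]
  module

end Orthonormal

section

attribute [local instance 100] LieRing.ofAssociativeRing

/-- `Y(n)` as a linear function of `Y`. -/
def modeₗ (n : ℤ) : sl2 →ₗ[ℂ] U :=
  (UniversalEnvelopingAlgebra.ι ℂ : Affine →ₗ⁅ℂ⁆ U).toLinearMap.comp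
    { toFun := fun Y => loopElt Y n
      map_add' := fun Y Z => by
        rw [loopElt, loopElt, loopElt, ← LieAlgebra.of_add, TensorProduct.tmul_add, Prod.mk_add_mk,
          add_zero]
      map_smul' := fun c Y => by
        rw [loopElt, loopElt, RingHom.id_apply, ← LieAlgebra.of_smul, TensorProduct.tmul_smul,
          Prod.smul_mk, smul_zero] }

end

theorem mode_add (Y Z : sl2) (n : ℤ) : mode (Y + Z) n = mode Y n + mode Z n :=
  map_add (modeₗ n) Y Z

theorem mode_smul (c : ℂ) (Y : sl2) (n : ℤ) : mode (c • Y) n = c • mode Y n :=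
  map_smul (modeₗ n) c Y

theorem mode_neg (Y : sl2) (n : ℤ) : mode (-Y) n = -mode Y n :=
  map_neg (modeₗ n) Y

theorem mode_zero_left (n : ℤ) : mode 0 n = 0 :=
  map_zero (modeₗ n)

theorem mode_sum {ι : Type*} (s : Finset ι) (Y : ι → sl2) (n : ℤ) :
    mode (∑ i ∈ s, Y i) n = ∑ i ∈ s, mode (Y i) n :=
  map_sum (modeₗ n) Y s

theorem mode_eq_smul_E_add_smul_F_add_smul_H (Y : sl2) (n : ℤ) :
    mode Y n = Y.1 0 1 • mode E n + Y.1 1 0 • mode F n + Y.1 0 0 • mode H n := by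
  conv_lhs => rw [eq_smul_E_add_smul_F_add_smul_H Y]
  simp only [mode_add, mode_smul]

/-- `Y(p) Z(q)` as a bilinear function of `Y` and `Z`. -/
def mulMode (p q : ℤ) : sl2 →ₗ[ℂ] sl2 →ₗ[ℂ] U :=
  (LinearMap.mul ℂ U).compl₁₂ (modeₗ p) (modeₗ q)

theorem smul_mem_of_mode_smul_mem {V : Type*} [AddCommGroup V] [Module ℂ V] [Module U V]
    [IsScalarTower ℂ U V] {P : Submodule ℂ V} (hmode : ∀ Y n, ∀ w ∈ P, mode Y n • w ∈ P)
    (hmodeK : ∀ w ∈ P, modeK • w ∈ P) (u : U) : ∀ w ∈ P, u • w ∈ P := by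
  obtain ⟨t, rfl⟩ : ∃ t, UniversalEnvelopingAlgebra.mkAlgHom ℂ Affine t = u :=
    RingCon.mkₐ_surjective _ u
  induction t using TensorAlgebra.induction with
  | algebraMap c =>
    intro w hw
    rw [AlgHom.commutes, algebraMap_smul]
    exact P.smul_mem c hw
  | ι x =>
    change ∀ w ∈ P, UniversalEnvelopingAlgebra.ι ℂ x • w ∈ P
    induction x using affine_induction with
    | hadd x y hx hy =>
      intro w hw
      rw [map_add, add_smul]
      exact P.add_mem (hx w hw) (hy w hw)
    | hloop Y n => exact hmode Y n
    | hcentral c =>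
      intro w hw
      rw [ι_smul_central, smul_assoc]
      exact P.smul_mem c (hmodeK w hw)
  | mul a b ha hb =>
    intro w hw
    rw [map_mul, mul_smul]
    exact ha _ (hb w hw)
  | add a b ha hb =>
    intro w hw
    rw [map_add, add_smul]
    exact P.add_mem (ha w hw) (hb w hw)

section Casimir

/-- `∑_r X_r(p) X_r(q)`. -/
def casimirMode (X : Fin 3 → sl2) (p q : ℤ) : U := ∑ r, mode (X r) p * mode (X r) q

/-- `∑_r X_r(p) [Y, X_r](q)`; commutators of `Y(m)` with the elements `casimirMode X p q` are
differences of such elements. -/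
def adCasimirMode (X : Fin 3 → sl2) (Y : sl2) (p q : ℤ) : U :=
  ∑ r, mode (X r) p * mode ⁅Y, X r⁆ q

variable {X : Module.Basis (Fin 3) ℂ sl2} (hX : ∀ r s, form (X r) (X s) = if r = s then 1 else 0)

include hX

theorem casimirMode_eq (p q : ℤ) : casimirMode X p q =
    mode E p * mode F q + mode F p * mode E q + (1 / 2 : ℂ) • (mode H p * mode H q) :=
  sum_map_self hX (mulMode p q)

theorem sum_mode_lie_mul_mode (Y : sl2) (p q : ℤ) :
    ∑ r, mode ⁅Y, X r⁆ p * mode (X r) q = -adCasimirMode X Y p q :=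
  sum_map_lie hX (mulMode p q) Y

theorem adCasimirMode_add_adCasimirMode (Y : sl2) (p q : ℤ) :
    adCasimirMode X Y p q + adCasimirMode X Y q p = (-4 : ℂ) • mode Y (p + q) := by
  have hcomm (r : Fin 3) : mode (X r) p * mode ⁅Y, X r⁆ q - mode ⁅Y, X r⁆ q * mode (X r) p
      = -mode ⁅⁅Y, X r⁆, X r⁆ (p + q) := by
    rw [mode_mul_mode (X r), form_lie_self, ← lie_skew (X r), mode_neg]
    simp only [mul_zero, ite_self, zero_smul, add_zero]
    abel
  rw [← neg_neg (adCasimirMode X Y q p), ← sum_mode_lie_mul_mode hX, ← sub_eq_add_neg,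
    adCasimirMode, ← Finset.sum_sub_distrib, Finset.sum_congr rfl fun r _ => hcomm r,
    Finset.sum_neg_distrib, ← mode_sum, sum_lie_lie hX, mode_smul, neg_smul]

theorem mode_mul_casimirMode (Y : sl2) (m p q : ℤ) :
    mode Y m * casimirMode X p q = casimirMode X p q * mode Y m
      + (adCasimirMode X Y p (q + m) - adCasimirMode X Y (p + m) q)
      + ((if m + p = 0 then (m : ℂ) else 0) • mode Y q
        + (if m + q = 0 then (m : ℂ) else 0) • mode Y p) * modeK := by
  have hsum (n : ℤ) : ∑ r, form Y (X r) • mode (X r) n = mode Y n := by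
    conv_rhs => rw [← sum_form_smul hX Y, mode_sum]
    exact Finset.sum_congr rfl fun r _ => by rw [mode_smul, form_comm]
  have hterm (r : Fin 3) : mode Y m * (mode (X r) p * mode (X r) q)
      = mode (X r) p * mode (X r) q * mode Y m
        + (mode (X r) p * mode ⁅Y, X r⁆ (q + m) + mode ⁅Y, X r⁆ (p + m) * mode (X r) q)
        + ((if m + p = 0 then (m : ℂ) else 0) • form Y (X r) • mode (X r) q
          + (if m + q = 0 then (m : ℂ) else 0) • form Y (X r) • mode (X r) p) * modeK := by
    have hK := mode_mul_modeK (X r) q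
    rw [← mul_assoc, mode_mul_mode Y, add_mul, add_mul, mul_assoc (mode (X r) p),
      mode_mul_mode Y (X r) m q]
    simp only [smul_smul, ite_mul, zero_mul, mul_add, add_mul, mul_smul_comm, smul_mul_assoc,
      mul_assoc, hK, add_comm m p, add_comm m q]
    abel
  rw [casimirMode, Finset.mul_sum, Finset.sum_congr rfl fun r _ => hterm r,
    Finset.sum_add_distrib, Finset.sum_add_distrib, Finset.sum_add_distrib,
    sum_mode_lie_mul_mode hX, ← Finset.sum_mul, ← Finset.sum_mul, Finset.sum_add_distrib,
    ← Finset.smul_sum, ← Finset.smul_sum, hsum, hsum, ← sub_eq_add_neg]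
  rfl

end Casimir

section HalfLine

open Filter Set

variable {W : Type*} [AddCommGroup W] {f g : ℤ → W}

theorem finite_Ici_inter_support (hf : ∀ᶠ j in atTop, f j = 0) (c : ℤ) :
    (Ici c ∩ Function.support f).Finite := by
  obtain ⟨N, hN⟩ := eventually_atTop.1 hf
  refine (finite_Ico c N).subset fun j ⟨hcj, hj⟩ => ⟨hcj, ?_⟩
  exact lt_of_not_ge fun hNj => hj (hN j hNj)

theorem finsum_Ici_add (hf : ∀ᶠ j in atTop, f j = 0) (hg : ∀ᶠ j in atTop, g j = 0) (c : ℤ) :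
    ∑ᶠ j ∈ Ici c, (f j + g j) = ∑ᶠ j ∈ Ici c, f j + ∑ᶠ j ∈ Ici c, g j :=
  finsum_mem_add_distrib' (finite_Ici_inter_support hf c) (finite_Ici_inter_support hg c)

theorem finsum_Ici_sub (hf : ∀ᶠ j in atTop, f j = 0) (hg : ∀ᶠ j in atTop, g j = 0) (c : ℤ) :
    ∑ᶠ j ∈ Ici c, (f j - g j) = ∑ᶠ j ∈ Ici c, f j - ∑ᶠ j ∈ Ici c, g j := by
  have hadd := finsum_Ici_add (f := fun j => f j - g j)
    (by filter_upwards [hf, hg] with j hfj hgj using by rw [hfj, hgj, sub_zero]) hg c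
  simp only [sub_add_cancel] at hadd
  rw [hadd, add_sub_cancel_right]

theorem finsum_Ici_eq_add_finsum_Ici (hf : ∀ᶠ j in atTop, f j = 0) (c : ℤ) :
    ∑ᶠ j ∈ Ici c, f j = f c + ∑ᶠ j ∈ Ici (c + 1), f j := by
  have hIci : Ici c = insert c (Ici (c + 1)) := by
    ext j
    simp only [mem_Ici, mem_insert_iff]
    omega
  rw [hIci, finsum_mem_insert' f (by simp) (finite_Ici_inter_support hf _)]

theorem finsum_Ici_comp_add_right (f : ℤ → W) (c m : ℤ) :
    ∑ᶠ j ∈ Ici c, f (j + m) = ∑ᶠ j ∈ Ici (c + m), f j := by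
  refine finsum_mem_eq_of_bijOn (· + m) ⟨?_, (add_left_injective m).injOn, ?_⟩ fun _ _ => rfl
  · exact fun j hj => by simpa only [mem_Ici, add_le_add_iff_right] using hj
  · exact fun j hj => ⟨j - m, by simp only [mem_Ici] at hj ⊢; omega, sub_add_cancel j m⟩

theorem finsum_Ici_single (i c : ℤ) (w : W) :
    ∑ᶠ j ∈ Ici c, (if j = i then w else 0) = if c ≤ i then w else 0 := by
  rw [finsum_eq_single _ i fun j hj => by simp only [if_neg hj, finsum_zero], if_pos rfl]
  exact finsum_eq_if

/-- Telescoping does not lose the boundary terms here: the two half-lines are exchanged, up to the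
shift by `m`, by the reflection `j ↦ N - j`. -/
theorem finsum_Ici_shift_sub_add {b : ℤ → W} {d : W} {N : ℤ} (hb : ∀ᶠ j in atTop, b j = 0)
    (hrefl : ∀ j, b j + b (N - j) = -d) (c m : ℤ) :
    ∑ᶠ j ∈ Ici c, (b (j + m) - b j) + ∑ᶠ j ∈ Ici (N + 1 - m - c), (b (j + m) - b j) = m • d := by
  have hshift : ∀ᶠ j in atTop, b (j + m) = 0 := (tendsto_atTop_add_const_right _ m tendsto_id) hb
  have hstep (i : ℤ) : ∑ᶠ j ∈ Ici (i + 1), b j - ∑ᶠ j ∈ Ici (N + 1 - (i + 1)), b j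
      = ∑ᶠ j ∈ Ici i, b j - ∑ᶠ j ∈ Ici (N + 1 - i), b j + d := by
    rw [finsum_Ici_eq_add_finsum_Ici hb i, show N + 1 - (i + 1) = N - i by ring,
      finsum_Ici_eq_add_finsum_Ici hb (N - i), show N - i + 1 = N + 1 - i by ring,
      ← neg_eq_iff_eq_neg.2 (hrefl i)]
    abel
  let ψ : AddConstMap ℤ W 1 d := ⟨fun i => ∑ᶠ j ∈ Ici i, b j - ∑ᶠ j ∈ Ici (N + 1 - i), b j, hstep⟩
  have hψ : ψ (c + m) = ψ c + m • d := AddConstMapClass.map_add_int' ψ c m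
  rw [finsum_Ici_sub hshift hb, finsum_Ici_sub hshift hb, finsum_Ici_comp_add_right,
    finsum_Ici_comp_add_right]
  change ∑ᶠ j ∈ Ici (c + m), b j - ∑ᶠ j ∈ Ici (N + 1 - (c + m)), b j
    = ∑ᶠ j ∈ Ici c, b j - ∑ᶠ j ∈ Ici (N + 1 - c), b j + m • d at hψ
  rw [show N + 1 - m - c + m = N + 1 - c by ring, show N + 1 - m - c = N + 1 - (c + m) by ring,
    sub_add_sub_comm, add_comm, sub_eq_iff_eq_add]
  rw [sub_eq_iff_eq_add] at hψ
  rw [hψ]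
  abel

theorem finsum_ite_lt_eq (n : ℤ) (hg : ∀ᶠ j in atTop, g j = 0) :
    ∑ᶠ j, (if n - j < j then g j else g (n - j))
      = ∑ᶠ j ∈ Ici (n / 2 + 1), g j + ∑ᶠ j ∈ Ici (n - n / 2), g j := by
  set c := n / 2 + 1
  have hreflect : BijOn (n - ·) (Iio c) (Ici (n - n / 2)) := by
    refine ⟨fun j hj => ?_, sub_right_injective.injOn, fun j hj => ⟨n - j, ?_, sub_sub_cancel n j⟩⟩
      <;> simp only [mem_Ici, mem_Iio] at hj ⊢ <;> omega
  have hupper : ∀ j ∈ Ici c, (if n - j < j then g j else g (n - j)) = g j := fun j hj =>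
    if_pos (by rw [mem_Ici] at hj; omega)
  have hlower : ∀ j ∈ Iio c, (if n - j < j then g j else g (n - j)) = g (n - j) := fun j hj =>
    if_neg (by rw [mem_Iio] at hj; omega)
  rw [← finsum_mem_univ, ← Iio_union_Ici (a := c), union_comm, finsum_mem_union'
    (Iio_disjoint_Ici le_rfl).symm, finsum_mem_congr rfl hupper, finsum_mem_congr rfl hlower,
    finsum_mem_eq_of_bijOn (n - ·) hreflect fun _ _ => rfl]
  · refine (finite_Ici_inter_support hg c).subset fun j ⟨hj, hne⟩ => ⟨hj, ?_⟩
    rwa [Function.mem_support, hupper j hj] at hne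
  · refine ((finite_Ici_inter_support hg (n - n / 2)).preimage
      sub_right_injective.injOn).subset fun j ⟨hj, hne⟩ => ⟨hreflect.mapsTo hj, ?_⟩
    rwa [Function.mem_support, hlower j hj] at hne

end HalfLine

/-- A representation has level `k` if the central element `K` acts on it as `k`. -/
def HasLevel (V : Type*) [AddCommGroup V] [Module ℂ V] [Module U V] (k : ℂ) : Prop :=
  ∀ w : V, modeK • w = k • w

theorem mode_smul_mode_smul {V : Type*} [AddCommGroup V] [Module ℂ V] [Module U V]
    [IsScalarTower ℂ U V] {k : ℂ} (hk : HasLevel V k) (Y Z : sl2) (m n : ℤ) (w : V) :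
    mode Y m • mode Z n • w = mode Z n • mode Y m • w + mode ⁅Y, Z⁆ (m + n) • w
      + (if m + n = 0 then m * form Y Z * k else 0) • w := by
  rw [← mul_smul, mode_mul_mode, add_smul, add_smul, mul_smul, smul_assoc, hk, smul_smul _ k,
    ite_mul, zero_mul]

section Sugawara

open Filter Set

variable {V : Type*} [AddCommGroup V] [Module U V]

theorem IsSmooth.eventually_mode_smul_eq_zero (hV : IsSmooth V) (w : V) :
    ∀ᶠ n in atTop, ∀ Y, mode Y n • w = 0 :=
  eventually_atTop.2 (hV w)

theorem IsSmooth.eventually_casimirMode_smul_eq_zero (hV : IsSmooth V) (X : Fin 3 → sl2) (n : ℤ)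
    (w : V) : ∀ᶠ j in atTop, casimirMode X (n - j) j • w = 0 := by
  filter_upwards [hV.eventually_mode_smul_eq_zero w] with j hj
  rw [casimirMode, Finset.sum_smul]
  exact Finset.sum_eq_zero fun r _ => by rw [mul_smul, hj, smul_zero]

theorem IsSmooth.eventually_adCasimirMode_smul_eq_zero (hV : IsSmooth V) (X : Fin 3 → sl2)
    (Y : sl2) (n : ℤ) (w : V) : ∀ᶠ j in atTop, adCasimirMode X Y (n - j) j • w = 0 := by
  filter_upwards [hV.eventually_mode_smul_eq_zero w] with j hj
  rw [adCasimirMode, Finset.sum_smul]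
  exact Finset.sum_eq_zero fun r _ => by rw [mul_smul, hj, smul_zero]

variable [Module ℂ V] [IsScalarTower ℂ U V]

theorem sugawara_apply (hV : IsSmooth V) (k : ℂ) (X : Fin 3 → sl2) (n : ℤ) (w : V) :
    sugawara hV k X n w = (1 / (2 * (k + dualCoxeter))) •
      (∑ᶠ j ∈ Ici (n / 2 + 1), casimirMode X (n - j) j • w
        + ∑ᶠ j ∈ Ici (n - n / 2), casimirMode X (n - j) j • w) := by
  have hterm (j : ℤ) : ∑ a, normalOrdered (X a) (X a) (n - j) j • w
      = if n - j < j then casimirMode X (n - j) j • w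
        else casimirMode X (n - (n - j)) (n - j) • w := by
    simp only [normalOrdered, casimirMode, Finset.sum_smul, sub_sub_cancel]
    split_ifs <;> rfl
  rw [← finsum_ite_lt_eq n (hV.eventually_casimirMode_smul_eq_zero X n w), sugawara,
    LinearMap.smul_apply, LinearMap.sum_apply, ← finsum_congr hterm,
    finsum_sum_comm _ _ fun a _ => hV.finite_support (X a) (X a) n w]
  rfl

variable {X : Module.Basis (Fin 3) ℂ sl2} (hX : ∀ r s, form (X r) (X s) = if r = s then 1 else 0)
  {k : ℂ}

include hX

/-- The left-hand side is, up to the factor `-2 (k + h^∨)`, the commutator of `L_n` with `Y(m)`: the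
bracket `[X_r, [Y, X_r]]` contributes the dual Coxeter number, the central terms the level. -/
theorem mode_smul_casimirMode_smul (hk : HasLevel V k) (Y : sl2) (m n j : ℤ) (w : V) :
    mode Y m • casimirMode X (n - j) j • w = casimirMode X (n - j) j • mode Y m • w
      + (adCasimirMode X Y (n + m - (j + m)) (j + m) • w - adCasimirMode X Y (n + m - j) j • w)
      + ((if j = n + m then (m * k) • mode Y (m + n) • w else 0)
        + if j = -m then (m * k) • mode Y (m + n) • w else 0) := by
  have hp : m + (n - j) = 0 ↔ j = n + m := by omega
  have hq : m + j = 0 ↔ j = -m := by omega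
  have hdelta : (((if m + (n - j) = 0 then (m : ℂ) else 0) • mode Y j
      + (if m + j = 0 then (m : ℂ) else 0) • mode Y (n - j)) * modeK) • w
        = (if j = n + m then (m * k) • mode Y (m + n) • w else 0)
          + if j = -m then (m * k) • mode Y (m + n) • w else 0 := by
    rw [mul_smul, hk w, smul_comm _ k, add_smul, smul_add]
    simp only [hp, hq]
    congr 1 <;> split_ifs with hj
    · rw [hj, add_comm n m, smul_assoc, smul_smul, mul_comm]
    · rw [zero_smul, zero_smul, smul_zero]
    · rw [hj, sub_neg_eq_add, add_comm n m, smul_assoc, smul_smul, mul_comm]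
    · rw [zero_smul, zero_smul, smul_zero]
  rw [← mul_smul, mode_mul_casimirMode hX, add_smul, add_smul, sub_smul, mul_smul, hdelta,
    show n - j + m = n + m - j by ring, add_sub_add_right_eq_sub]

theorem mode_smul_finsum_casimirMode_smul (hV : IsSmooth V) (hk : HasLevel V k) (Y : sl2)
    (m n c : ℤ) (w : V) :
    mode Y m • ∑ᶠ j ∈ Ici c, casimirMode X (n - j) j • w
      = ∑ᶠ j ∈ Ici c, casimirMode X (n - j) j • mode Y m • w
        + ∑ᶠ j ∈ Ici c, (adCasimirMode X Y (n + m - (j + m)) (j + m) • w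
          - adCasimirMode X Y (n + m - j) j • w)
        + ((if c ≤ n + m then (m * k) • mode Y (m + n) • w else 0)
          + if c ≤ -m then (m * k) • mode Y (m + n) • w else 0) := by
  have hsingle (i : ℤ) (u : V) : ∀ᶠ j in atTop, (if j = i then u else 0) = 0 := by
    filter_upwards [eventually_gt_atTop i] with j hj using if_neg hj.ne'
  have had := hV.eventually_adCasimirMode_smul_eq_zero X Y (n + m) w
  have had' : ∀ᶠ j in atTop, adCasimirMode X Y (n + m - (j + m)) (j + m) • w = 0 :=
    (tendsto_atTop_add_const_right _ m tendsto_id) had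
  have hsub : ∀ᶠ j in atTop, adCasimirMode X Y (n + m - (j + m)) (j + m) • w
      - adCasimirMode X Y (n + m - j) j • w = 0 := by
    filter_upwards [had, had'] with j hj hj' using by rw [hj, hj', sub_zero]
  have hcas := hV.eventually_casimirMode_smul_eq_zero X n (mode Y m • w)
  rw [← finsum_Ici_single (n + m), ← finsum_Ici_single (-m),
    ← finsum_Ici_add (hsingle _ _) (hsingle _ _), ← finsum_Ici_add hcas hsub,
    ← finsum_Ici_add]
  · exact ((DistribSMul.toAddMonoidHom V (mode Y m)).map_finsum_mem' (finite_Ici_inter_support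
      (hV.eventually_casimirMode_smul_eq_zero X n w) c)).trans
      (finsum_mem_congr rfl fun j _ => mode_smul_casimirMode_smul hX hk Y m n j w)
  · filter_upwards [hcas, hsub] with j hj hj' using by rw [hj, hj', add_zero]
  · filter_upwards [hsingle (n + m) ((m * k) • mode Y (m + n) • w),
      hsingle (-m) ((m * k) • mode Y (m + n) • w)] with j hj hj' using by rw [hj, hj', add_zero]

theorem mode_smul_sugawara (hV : IsSmooth V) (hk : HasLevel V k) (hk0 : k + dualCoxeter ≠ 0)
    (Y : sl2) (m n : ℤ) (w : V) :
    mode Y m • sugawara hV k X n w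
      = sugawara hV k X n (mode Y m • w) + (m : ℂ) • mode Y (m + n) • w := by
  have htelescope := finsum_Ici_shift_sub_add (N := n + m) (d := (4 : ℂ) • mode Y (m + n) • w)
    (hV.eventually_adCasimirMode_smul_eq_zero X Y (n + m) w) (fun j => by
      rw [sub_sub_cancel, ← add_smul, add_comm, adCasimirMode_add_adCasimirMode hX,
        add_sub_cancel, smul_assoc, neg_smul, add_comm n m]) (n / 2 + 1) m
  rw [show n + m + 1 - m - (n / 2 + 1) = n - n / 2 by ring] at htelescope
  have hdelta (u : V) : ((if n / 2 + 1 ≤ n + m then u else 0) + if n / 2 + 1 ≤ -m then u else 0)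
      + ((if n - n / 2 ≤ n + m then u else 0) + if n - n / 2 ≤ -m then u else 0)
        = (2 : ℂ) • u := by
    rw [two_smul]
    have hright : n - n / 2 ≤ -m ↔ ¬n / 2 + 1 ≤ n + m := by omega
    have hleft : n - n / 2 ≤ n + m ↔ ¬n / 2 + 1 ≤ -m := by omega
    simp only [hright, hleft, ite_not]
    split_ifs <;> abel
  have hcoeff : (m : ℂ) = 1 / (2 * (k + dualCoxeter)) * (m * 4 + 2 * (m * k)) := by
    field_simp
    rw [dualCoxeter]
    ring
  rw [sugawara_apply, sugawara_apply, smul_comm (mode Y m), smul_add,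
    mode_smul_finsum_casimirMode_smul hX hV hk, mode_smul_finsum_casimirMode_smul hX hV hk,
    add_add_add_comm, add_add_add_comm (finsum _), hdelta, htelescope, add_assoc, smul_add,
    ← Int.cast_smul_eq_zsmul ℂ, smul_smul, smul_smul, ← add_smul, smul_smul, ← hcoeff]

end Sugawara

section HighestWeight

variable {V : Type*} [AddCommGroup V] [Module U V]

/-- The modes `E(-n-1)`, `F(-n)`, `H(-n-1)` with `n ≥ 0`, which span the complement of the Borel
subalgebra, together with their degrees in the principal gradation, in which `F(0)` and `E(-1)`
have degree one. -/
inductive IsLoweringMode : ℕ → sl2 → ℤ → Prop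
  | ofE (n : ℕ) : IsLoweringMode (2 * n + 1) E (-(n + 1))
  | ofF (n : ℕ) : IsLoweringMode (2 * n + 1) F (-n)
  | ofH (n : ℕ) : IsLoweringMode (2 * n + 2) H (-(n + 1))

/-- The vectors obtained from `s` by applying lowering modes, together with the sums of the degrees
of these modes. -/
inductive IsDescendant (s : V) : ℕ → V → Prop
  | refl : IsDescendant s 0 s
  | mode_smul {d e : ℕ} {Y : sl2} {m : ℤ} {w : V} (hY : IsLoweringMode d Y m)
      (hw : IsDescendant s e w) : IsDescendant s (e + d) (mode Y m • w)

theorem IsDescendant.eq_zero {e : ℕ} {w : V} (hw : IsDescendant 0 e w) : w = 0 := by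
  induction hw with
  | refl => rfl
  | mode_smul _ _ ih => rw [ih, smul_zero]

variable [Module ℂ V]

/-- A singular vector of weight `lam`: a vector which is annihilated by the nilradical of the Borel
subalgebra and on which `H(0)` acts as `lam`. It may be zero. -/
structure IsSingular (lam : ℂ) (v : V) : Prop where
  mode_pos_smul : ∀ n > 0, ∀ Y, mode Y n • v = 0
  E_smul : mode E 0 • v = 0
  H_smul : mode H 0 • v = lam • v

/-- The linear span of the descendants of a vector. -/
def descendantSpan (s : V) : Submodule ℂ V := Submodule.span ℂ {w | ∃ e, IsDescendant s e w}

variable {s : V}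

theorem IsDescendant.mem_descendantSpan {e : ℕ} {w : V} (hw : IsDescendant s e w) :
    w ∈ descendantSpan s :=
  Submodule.subset_span ⟨e, hw⟩

variable [IsScalarTower ℂ U V]

section Weight

variable {k lam : ℂ} {v : V} (hk : HasLevel V k)

include hk

theorem mode_pos_smul_mode_zero_smul {w : V} (hw : ∀ n > 0, ∀ Y, mode Y n • w = 0) (Z : sl2) :
    ∀ n > 0, ∀ Y, mode Y n • mode Z 0 • w = 0 := fun n hn Y => by
  rw [mode_smul_mode_smul hk, hw n hn, add_zero, hw n hn, if_neg hn.ne', smul_zero, zero_smul,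
    add_zero, add_zero]

theorem H_smul_mode_smul {w : V} {h : ℂ} (hw : mode H 0 • w = lam • w) {Y : sl2}
    (hY : ⁅H, Y⁆ = h • Y) (n : ℤ) :
    mode H 0 • mode Y n • w = (lam + h) • mode Y n • w := by
  rw [mode_smul_mode_smul hk, hw, hY, mode_smul, Int.cast_zero, zero_mul, zero_mul, ite_self,
    zero_smul, add_zero, zero_add, smul_assoc, smul_comm _ lam, add_smul]

theorem IsSingular.E_smul_F_smul (hv : IsSingular lam v) :
    mode E 0 • mode F 0 • v = lam • v := by
  rw [mode_smul_mode_smul hk, lie_E_F, hv.E_smul, add_zero, hv.H_smul, Int.cast_zero, zero_mul,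
    zero_mul, ite_self, zero_smul, smul_zero, zero_add, add_zero]

theorem IsSingular.E_neg_one_smul (hv : IsSingular k v) :
    IsSingular (k + 2) (mode E (-1) • v) where
  mode_pos_smul n hn Y := by
    rw [mode_smul_mode_smul hk, hv.mode_pos_smul n hn, smul_zero, zero_add]
    rcases (by omega : n = 1 ∨ 0 < n + -1) with rfl | hn1
    · have hlie : ⁅Y, E⁆ = -form Y E • H + (2 * Y.1 0 0) • E := by
        conv_lhs => rw [eq_smul_E_add_smul_F_add_smul_H Y]
        simp only [add_lie, smul_lie, lie_self, lie_F_E, lie_H_E, form_E]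
        module
      rw [add_neg_cancel, if_pos rfl, hlie, mode_add, add_smul, mode_smul, mode_smul, smul_assoc,
        smul_assoc, hv.E_smul, hv.H_smul]
      push_cast
      module
    · rw [hv.mode_pos_smul _ hn1, if_neg hn1.ne', zero_smul, add_zero]
  E_smul := by
    rw [mode_smul_mode_smul hk, lie_self, mode_zero_left, hv.E_smul, Int.cast_zero]
    simp
  H_smul := H_smul_mode_smul hk hv.H_smul lie_H_E (-1)

theorem IsSingular.F_smul_F_smul (hv : IsSingular 1 v) :
    IsSingular (1 + -2 + -2) (mode F 0 • mode F 0 • v) where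
  mode_pos_smul :=
    mode_pos_smul_mode_zero_smul hk (mode_pos_smul_mode_zero_smul hk hv.mode_pos_smul F) F
  E_smul := by
    rw [mode_smul_mode_smul hk, hv.E_smul_F_smul hk, lie_E_F, add_zero,
      H_smul_mode_smul hk hv.H_smul lie_H_F, Int.cast_zero, zero_mul, zero_mul, ite_self, one_smul,
      zero_smul, add_zero]
    generalize mode F 0 • v = w
    module
  H_smul := H_smul_mode_smul hk (H_smul_mode_smul hk hv.H_smul lie_H_F 0) lie_H_F 0

end Weight

theorem IsLoweringMode.smul_mem_descendantSpan {d : ℕ} {Y : sl2} {m : ℤ}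
    (hY : IsLoweringMode d Y m) {w : V} (hw : w ∈ descendantSpan s) :
    mode Y m • w ∈ descendantSpan s := by
  have hle : descendantSpan s ≤ (descendantSpan s).comap (act V (mode Y m)) :=
    Submodule.span_le.2 fun _ ⟨_, hw'⟩ => (hw'.mode_smul hY).mem_descendantSpan
  exact hle hw

theorem IsSingular.mode_smul_mem_descendantSpan {lam : ℂ} (hs : IsSingular lam s) (Y : sl2)
    (n : ℤ) : mode Y n • s ∈ descendantSpan s := by
  have hmem : s ∈ descendantSpan s := IsDescendant.refl.mem_descendantSpan
  rcases lt_trichotomy n 0 with hn | rfl | hn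
  · obtain ⟨i, rfl⟩ : ∃ i : ℕ, n = -(i + 1) := ⟨(-n - 1).toNat, by omega⟩
    have hF := IsLoweringMode.ofF (i + 1)
    rw [Nat.cast_add_one] at hF
    rw [mode_eq_smul_E_add_smul_F_add_smul_H Y]
    simp only [add_smul, smul_assoc]
    refine add_mem (add_mem ?_ ?_) ?_ <;> refine Submodule.smul_mem _ _ ?_
    · exact (IsLoweringMode.ofE i).smul_mem_descendantSpan hmem
    · exact hF.smul_mem_descendantSpan hmem
    · exact (IsLoweringMode.ofH i).smul_mem_descendantSpan hmem
  · rw [mode_eq_smul_E_add_smul_F_add_smul_H Y]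
    simp only [add_smul, smul_assoc, hs.E_smul, hs.H_smul, smul_zero, zero_add]
    refine add_mem (Submodule.smul_mem _ _ ?_) ?_
    · exact (IsLoweringMode.ofF 0).smul_mem_descendantSpan hmem
    · exact Submodule.smul_mem _ _ (Submodule.smul_mem _ _ hmem)
  · rw [hs.mode_pos_smul n hn]
    exact zero_mem _

theorem IsDescendant.mode_smul_mem_descendantSpan {k lam : ℂ} (hk : HasLevel V k)
    (hs : IsSingular lam s) {e : ℕ} {w : V} (hw : IsDescendant s e w) (Y : sl2) (n : ℤ) :
    mode Y n • w ∈ descendantSpan s := by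
  induction hw generalizing Y n with
  | refl => exact hs.mode_smul_mem_descendantSpan Y n
  | mode_smul hZ hw ih =>
    rw [mode_smul_mode_smul hk]
    exact add_mem (add_mem (hZ.smul_mem_descendantSpan (ih Y n)) (ih _ _))
      (Submodule.smul_mem _ _ hw.mem_descendantSpan)

theorem IsSingular.descendantSpan_eq_top [IsSimpleModule U V] {k lam : ℂ} (hk : HasLevel V k)
    (hs : IsSingular lam s) (hs0 : s ≠ 0) : descendantSpan s = ⊤ := by
  have hmode (Y : sl2) (n : ℤ) : ∀ w ∈ descendantSpan s, mode Y n • w ∈ descendantSpan s := by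
    have hle : descendantSpan s ≤ (descendantSpan s).comap (act V (mode Y n)) :=
      Submodule.span_le.2 fun _ ⟨_, hw⟩ => hw.mode_smul_mem_descendantSpan hk hs Y n
    exact fun w hw => hle hw
  have hmodeK : ∀ w ∈ descendantSpan s, modeK • w ∈ descendantSpan s := fun w hw => by
    rw [hk w]
    exact Submodule.smul_mem _ _ hw
  let P : Submodule U V :=
    { descendantSpan s with
      smul_mem' := fun u w hw => smul_mem_of_mode_smul_mem hmode hmodeK u w hw }
  have hsP : s ∈ P := IsDescendant.refl.mem_descendantSpan
  have hP : P = ⊤ := (eq_bot_or_eq_top P).resolve_left fun h => hs0 (by rwa [h] at hsP)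
  exact eq_top_iff.2 fun w _ => (hP ▸ Submodule.mem_top : w ∈ P)

end HighestWeight

section Primary

open Set

variable {V : Type*} [AddCommGroup V] [Module U V] {w : V} (hw : ∀ n > 0, ∀ Y, mode Y n • w = 0)

include hw

theorem casimirMode_smul_eq_zero (X : Fin 3 → sl2) (p : ℤ) {q : ℤ} (hq : 0 < q) :
    casimirMode X p q • w = 0 := by
  rw [casimirMode, Finset.sum_smul]
  exact Finset.sum_eq_zero fun r _ => by rw [mul_smul, hw q hq, smul_zero]

variable (X : Fin 3 → sl2)

theorem finsum_Ici_one_casimirMode_smul (n : ℤ) :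
    ∑ᶠ j ∈ Ici 1, casimirMode X (n - j) j • w = 0 :=
  finsum_mem_eq_zero_of_forall_eq_zero fun _ hj => casimirMode_smul_eq_zero hw X _ hj

variable (hV : IsSmooth V)

include hV

theorem finsum_Ici_zero_casimirMode_smul (n : ℤ) :
    ∑ᶠ j ∈ Ici 0, casimirMode X (n - j) j • w = casimirMode X n 0 • w := by
  rw [finsum_Ici_eq_add_finsum_Ici (hV.eventually_casimirMode_smul_eq_zero X n w), zero_add,
    finsum_Ici_one_casimirMode_smul hw, sub_zero, add_zero]

theorem finsum_Ici_neg_one_casimirMode_smul (n : ℤ) :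
    ∑ᶠ j ∈ Ici (-1), casimirMode X (n - j) j • w
      = casimirMode X (n + 1) (-1) • w + casimirMode X n 0 • w := by
  rw [finsum_Ici_eq_add_finsum_Ici (hV.eventually_casimirMode_smul_eq_zero X n w),
    neg_add_cancel, finsum_Ici_zero_casimirMode_smul hw X hV, sub_neg_eq_add]

variable [Module ℂ V] [IsScalarTower ℂ U V] (k : ℂ)

theorem sugawara_zero_apply :
    sugawara hV k X 0 w = (1 / (2 * (k + dualCoxeter))) • casimirMode X 0 0 • w := by
  rw [sugawara_apply]
  norm_num only
  rw [finsum_Ici_one_casimirMode_smul hw, finsum_Ici_zero_casimirMode_smul hw X hV, zero_add]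

theorem sugawara_neg_one_apply :
    sugawara hV k X (-1) w = (1 / (k + dualCoxeter)) • casimirMode X (-1) 0 • w := by
  rw [sugawara_apply]
  norm_num only
  rw [finsum_Ici_zero_casimirMode_smul hw X hV, ← two_smul ℂ, smul_smul]
  congr 1
  rw [one_div, one_div, mul_inv]
  ring

theorem sugawara_neg_two_apply :
    sugawara hV k X (-2) w = (1 / (2 * (k + dualCoxeter))) •
      ((2 : ℂ) • casimirMode X (-2) 0 • w + casimirMode X (-1) (-1) • w) := by
  rw [sugawara_apply]
  norm_num only
  rw [finsum_Ici_zero_casimirMode_smul hw X hV, finsum_Ici_neg_one_casimirMode_smul hw X hV,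
    two_smul]
  norm_num only
  congr 1
  abel

end Primary

section Degree

variable {V : Type*} [AddCommGroup V] [Module ℂ V] [Module U V] [IsScalarTower ℂ U V]

/-- The operator `2 L_0 - H(0)/2`, whose eigenvalues on the descendants of a singular vector
increase by the degrees of the lowering modes applied. -/
def degreeOperator (hV : IsSmooth V) (k : ℂ) (X : Fin 3 → sl2) : Module.End ℂ V :=
  (2 : ℂ) • sugawara hV k X 0 - (1 / 2 : ℂ) • act V (mode H 0)

theorem degreeOperator_apply (hV : IsSmooth V) (k : ℂ) (X : Fin 3 → sl2) (w : V) :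
    degreeOperator hV k X w = (2 : ℂ) • sugawara hV k X 0 w - (1 / 2 : ℂ) • mode H 0 • w := rfl

theorem IsLoweringMode.exists_lie_H_eq_smul {d : ℕ} {Y : sl2} {m : ℤ} (hY : IsLoweringMode d Y m) :
    ∃ h : ℂ, ⁅H, Y⁆ = h • Y ∧ (d : ℂ) = -(2 * m) - h / 2 := by
  cases hY with
  | ofE n => exact ⟨2, lie_H_E, by push_cast; ring⟩
  | ofF n => exact ⟨-2, lie_H_F, by push_cast; ring⟩
  | ofH n => exact ⟨0, by rw [lie_self, zero_smul], by push_cast; ring⟩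

variable {X : Module.Basis (Fin 3) ℂ sl2} (hX : ∀ r s, form (X r) (X s) = if r = s then 1 else 0)
  (hV : IsSmooth V) {k : ℂ}

include hX hV

theorem degreeOperator_mode_smul (hk : HasLevel V k) (hk0 : k + dualCoxeter ≠ 0) {d : ℕ} {Y : sl2}
    {m : ℤ} (hY : IsLoweringMode d Y m) (w : V) :
    degreeOperator hV k X (mode Y m • w)
      = mode Y m • degreeOperator hV k X w + (d : ℂ) • mode Y m • w := by
  obtain ⟨h, hH, hd⟩ := hY.exists_lie_H_eq_smul
  have hL := mode_smul_sugawara hX hV hk hk0 Y m 0 w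
  have hcomm : mode H 0 • mode Y m • w = mode Y m • mode H 0 • w + h • mode Y m • w := by
    rw [mode_smul_mode_smul hk, hH, mode_smul, Int.cast_zero, zero_mul, zero_mul, ite_self,
      zero_smul, add_zero, zero_add, smul_assoc]
  rw [add_zero] at hL
  rw [degreeOperator_apply, degreeOperator_apply, eq_sub_of_add_eq hL.symm, hcomm,
    smul_sub (mode Y m), smul_comm _ (2 : ℂ), smul_comm _ (1 / 2 : ℂ), hd]
  generalize mode Y m • sugawara hV k X 0 w = x, mode Y m • mode H 0 • w = y, mode Y m • w = z
  module

theorem IsDescendant.degreeOperator_apply (hk : HasLevel V k) (hk0 : k + dualCoxeter ≠ 0)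
    {s : V} {a : ℂ} (hs : degreeOperator hV k X s = a • s) {e : ℕ} {w : V}
    (hw : IsDescendant s e w) : degreeOperator hV k X w = (a + e) • w := by
  induction hw with
  | refl => rw [hs, Nat.cast_zero, add_zero]
  | mode_smul hY _ ih =>
    rw [degreeOperator_mode_smul hX hV hk hk0 hY, ih, smul_comm (mode _ _), ← add_smul,
      Nat.cast_add, add_assoc]

theorem IsSingular.exists_degreeOperator_eq_smul (hk : HasLevel V k) {lam : ℂ} {v : V}
    (hv : IsSingular lam v) : ∃ a : ℂ, degreeOperator hV k X v = a • v := by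
  refine ⟨2 * (1 / (2 * (k + dualCoxeter)) * (lam + 1 / 2 * (lam * lam))) - 1 / 2 * lam, ?_⟩
  rw [degreeOperator_apply, sugawara_zero_apply hv.mode_pos_smul, casimirMode_eq hX]
  simp only [add_smul, smul_assoc, mul_smul, sub_smul, hv.E_smul_F_smul hk, hv.E_smul, hv.H_smul,
    smul_comm (mode H 0) lam, smul_zero, add_zero]

theorem IsSingular.eq_zero_of_isDescendant [IsSimpleModule U V] (hk : HasLevel V k)
    (hk0 : k + dualCoxeter ≠ 0) {lam mu : ℂ} {v s : V} (hv : IsSingular lam v)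
    (hs : IsSingular mu s) {d : ℕ} (hd : 0 < d) (hvs : IsDescendant v d s) : s = 0 := by
  -- Otherwise the descendants of `s`, all of larger degree than `v`, span the representation.
  by_contra hs0
  obtain ⟨a, ha⟩ := hv.exists_degreeOperator_eq_smul hX hV hk
  have hspan : descendantSpan s ≤ ⨆ b, ⨆ _ : b ≠ a, (degreeOperator hV k X).eigenspace b := by
    refine Submodule.span_le.2 fun w ⟨e, hw⟩ => ?_
    have hne : a + d + e ≠ a := by
      rw [add_assoc, Ne, add_eq_left]
      exact_mod_cast (by omega : d + e ≠ 0)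
    refine Submodule.mem_iSup_of_mem (a + d + e) (Submodule.mem_iSup_of_mem hne ?_)
    exact Module.End.mem_eigenspace_iff.2
      (hw.degreeOperator_apply hX hV hk hk0 (hvs.degreeOperator_apply hX hV hk hk0 ha))
  rw [hs.descendantSpan_eq_top hk hs0, top_le_iff] at hspan
  have hdisjoint := (Module.End.eigenspaces_iSupIndep (degreeOperator hV k X)) a
  have hv0 : v = 0 := by
    rw [hspan, disjoint_top] at hdisjoint
    rw [← Submodule.mem_bot ℂ, ← hdisjoint]
    exact Module.End.mem_eigenspace_iff.2 ha
  subst hv0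
  exact hs0 hvs.eq_zero

end Degree

section NullVectors

variable {V : Type*} [AddCommGroup V] [Module ℂ V] [Module U V] [IsScalarTower ℂ U V]
  [IsSimpleModule U V] {X : Module.Basis (Fin 3) ℂ sl2}
  (hX : ∀ r s, form (X r) (X s) = if r = s then 1 else 0) (hV : IsSmooth V) {k : ℂ}
  (hk : HasLevel V k) (hk0 : k + dualCoxeter ≠ 0) {v : V}

include hX hV hk hk0

theorem IsSingular.E_neg_one_smul_eq_zero (hv : IsSingular k v) : mode E (-1) • v = 0 :=
  hv.eq_zero_of_isDescendant hX hV hk hk0 (hv.E_neg_one_smul hk) one_pos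
    (IsDescendant.refl.mode_smul (.ofE 0))

theorem IsSingular.F_smul_F_smul_eq_zero (hv : IsSingular 1 v) : mode F 0 • mode F 0 • v = 0 :=
  hv.eq_zero_of_isDescendant hX hV hk hk0 (hv.F_smul_F_smul hk) two_pos
    ((IsDescendant.refl.mode_smul (.ofF 0)).mode_smul (.ofF 0))

end NullVectors

section Relations

variable {V : Type*} [AddCommGroup V] [Module ℂ V] [Module U V] [IsScalarTower ℂ U V] {k : ℂ}
  (hk : HasLevel V k) {v : V} (hE : mode E (-1) • v = 0)

include hk hE

theorem E_neg_one_smul_F_smul : mode E (-1) • mode F 0 • v = mode H (-1) • v := by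
  rw [mode_smul_mode_smul hk, hE, smul_zero, zero_add, lie_E_F]
  norm_num

theorem E_neg_one_smul_F_neg_one_smul : mode E (-1) • mode F (-1) • v = mode H (-2) • v := by
  rw [mode_smul_mode_smul hk, hE, smul_zero, zero_add, lie_E_F]
  norm_num

variable (hFF : mode F 0 • mode F 0 • v = 0)

include hFF

theorem H_neg_one_smul_F_smul : mode H (-1) • mode F 0 • v = -mode F (-1) • v := by
  -- Move `F(0)` to the right in `F(0) E(-1) F(0) v = F(0) H(-1) v`.
  have hleft : mode F 0 • mode E (-1) • mode F 0 • v = -mode H (-1) • mode F 0 • v := by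
    rw [mode_smul_mode_smul hk, hFF, smul_zero, lie_F_E, neg_one_smul, mode_neg]
    norm_num
  have hright : mode F 0 • mode H (-1) • v
      = mode H (-1) • mode F 0 • v + (2 : ℂ) • mode F (-1) • v := by
    rw [mode_smul_mode_smul hk, lie_F_H, mode_smul]
    norm_num
  rw [E_neg_one_smul_F_smul hk hE, hright, neg_smul] at hleft
  rw [neg_smul]
  generalize mode H (-1) • mode F 0 • v = x, mode F (-1) • v = y at hleft ⊢
  linear_combination (norm := module) (1 / 2 : ℂ) • hleft

theorem E_neg_two_smul_F_smul : mode E (-2) • mode F 0 • v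
    = (1 / 2 : ℂ) • (mode H (-1) • mode H (-1) • v + mode H (-2) • v) := by
  have hcomm : mode H (-1) • mode E (-1) • mode F 0 • v
      = mode E (-1) • mode H (-1) • mode F 0 • v + (2 : ℂ) • mode E (-2) • mode F 0 • v := by
    rw [mode_smul_mode_smul hk, lie_H_E, mode_smul]
    norm_num
  rw [E_neg_one_smul_F_smul hk hE, H_neg_one_smul_F_smul hk hE hFF, neg_smul, smul_neg,
    E_neg_one_smul_F_neg_one_smul hk hE] at hcomm
  rw [hcomm]
  generalize mode E (-2) • mode F 0 • v = x, mode H (-2) • v = y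
  module

end Relations

section LevelOne

variable {V : Type*} [AddCommGroup V] [Module ℂ V] [Module U V] [IsScalarTower ℂ U V]
  {X : Module.Basis (Fin 3) ℂ sl2}
  (hX : ∀ r s, form (X r) (X s) = if r = s then 1 else 0)

include hX

theorem casimirMode_neg_one_neg_one_smul {k : ℂ} (hk : HasLevel V k) {v : V}
    (hE : mode E (-1) • v = 0) : casimirMode X (-1) (-1) • v
      = mode H (-2) • v + (1 / 2 : ℂ) • mode H (-1) • mode H (-1) • v := by
  rw [casimirMode_eq hX, add_smul, add_smul, mul_smul, mul_smul, smul_assoc, mul_smul,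
    E_neg_one_smul_F_neg_one_smul hk hE, hE, smul_zero, add_zero]

theorem IsSingular.casimirMode_neg_one_zero_smul {k : ℂ} (hk : HasLevel V k) {v : V}
    (hv : IsSingular 1 v) (hE : mode E (-1) • v = 0) :
    casimirMode X (-1) 0 • v = (3 / 2 : ℂ) • mode H (-1) • v := by
  rw [casimirMode_eq hX, add_smul, add_smul, mul_smul, mul_smul, smul_assoc, mul_smul,
    E_neg_one_smul_F_smul hk hE, hv.E_smul, hv.H_smul, one_smul, smul_zero]
  generalize mode H (-1) • v = x
  module

theorem IsSingular.casimirMode_neg_two_zero_smul {k : ℂ} (hk : HasLevel V k) {v : V}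
    (hv : IsSingular 1 v) (hE : mode E (-1) • v = 0) (hFF : mode F 0 • mode F 0 • v = 0) :
    casimirMode X (-2) 0 • v = casimirMode X (-1) (-1) • v := by
  rw [casimirMode_neg_one_neg_one_smul hX hk hE, casimirMode_eq hX, add_smul, add_smul, mul_smul,
    mul_smul, smul_assoc, mul_smul, E_neg_two_smul_F_smul hk hE hFF, hv.E_smul, hv.H_smul,
    one_smul, smul_zero]
  generalize mode H (-1) • mode H (-1) • v = x, mode H (-2) • v = y
  module

variable (hV : IsSmooth V)

theorem IsSingular.sugawara_neg_one_apply {k : ℂ} (hk : HasLevel V k) {v : V}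
    (hv : IsSingular 1 v) (hE : mode E (-1) • v = 0) :
    sugawara hV 1 X (-1) v = (1 / 2 : ℂ) • mode H (-1) • v := by
  rw [AffineSl2.sugawara_neg_one_apply hv.mode_pos_smul,
    hv.casimirMode_neg_one_zero_smul hX hk hE, smul_smul, dualCoxeter]
  norm_num

theorem IsSingular.sugawara_neg_two_apply {k : ℂ} (hk : HasLevel V k) {v : V}
    (hv : IsSingular 1 v) (hE : mode E (-1) • v = 0) (hFF : mode F 0 • mode F 0 • v = 0) :
    sugawara hV 1 X (-2) v = (1 / 2 : ℂ) • casimirMode X (-1) (-1) • v := by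
  rw [AffineSl2.sugawara_neg_two_apply hv.mode_pos_smul,
    hv.casimirMode_neg_two_zero_smul hX hk hE hFF, dualCoxeter]
  generalize casimirMode X (-1) (-1) • v = x
  module

theorem IsSingular.sugawara_neg_one_sq_apply (hk : HasLevel V 1) {v : V}
    (hv : IsSingular 1 v) (hE : mode E (-1) • v = 0) :
    (sugawara hV 1 X (-1) ^ 2) v = (1 / 2 : ℂ) • casimirMode X (-1) (-1) • v := by
  have hL1 := hv.sugawara_neg_one_apply hX hV hk hE
  have hcomm := mode_smul_sugawara hX hV hk (by norm_num [dualCoxeter]) H (-1) (-1) v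
  rw [hL1, smul_comm, Int.cast_neg, Int.cast_one, neg_one_smul, ← sub_eq_add_neg,
    eq_sub_iff_add_eq] at hcomm
  rw [pow_two, Module.End.mul_apply, hL1, map_smul, ← hcomm,
    casimirMode_neg_one_neg_one_smul hX hk hE, add_comm]
  norm_num

end LevelOne

section NullOperator

variable {V : Type*} [AddCommGroup V] [Module ℂ V] [Module U V] [IsScalarTower ℂ U V]

/-- The operator `-2 L_{-2} + (κ/2) L_{-1}² + (τ/2) ∑_r X_r(-1)²` on a smooth representation of
level one. -/
def nullOperator (hV : IsSmooth V) (X : Fin 3 → sl2) (κ τ : ℂ) : Module.End ℂ V :=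
  (-2 : ℂ) • sugawara hV 1 X (-2) + (κ / 2) • sugawara hV 1 X (-1) ^ 2
    + (τ / 2) • ∑ r, act V (mode (X r) (-1)) ^ 2

theorem sum_act_mode_sq (X : Fin 3 → sl2) (n : ℤ) :
    ∑ r, act V (mode (X r) n) ^ 2 = act V (casimirMode X n n) := by
  refine Eq.trans ?_ (map_sum (Algebra.lsmul ℂ ℂ V) _ _).symm
  exact Finset.sum_congr rfl fun r _ => by rw [pow_two, ← map_mul]

theorem nullOperator_apply (hV : IsSmooth V) (X : Fin 3 → sl2) (κ τ : ℂ) (w : V) :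
    nullOperator hV X κ τ w =
      (-2 : ℂ) • sugawara hV 1 X (-2) w + (κ / 2) • (sugawara hV 1 X (-1) ^ 2) w
        + (τ / 2) • casimirMode X (-1) (-1) • w := by
  rw [nullOperator, sum_act_mode_sq]
  rfl

variable {X : Module.Basis (Fin 3) ℂ sl2} (hX : ∀ r s, form (X r) (X s) = if r = s then 1 else 0)

include hX

theorem commute_act_mode_zero_sugawara (hV : IsSmooth V) {k : ℂ} (hk : HasLevel V k)
    (hk0 : k + dualCoxeter ≠ 0) (Y : sl2) (n : ℤ) :
    Commute (act V (mode Y 0)) (sugawara hV k X n) := LinearMap.ext fun w => by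
  have h := mode_smul_sugawara hX hV hk hk0 Y 0 n w
  rwa [Int.cast_zero, zero_smul, add_zero] at h

theorem commute_mode_zero_casimirMode (Y : sl2) (p q : ℤ) :
    Commute (mode Y 0) (casimirMode X p q) := by
  rw [Commute, SemiconjBy, mode_mul_casimirMode hX]
  simp only [add_zero, zero_add, sub_self, Int.cast_zero, ite_self, zero_smul, zero_mul]

theorem commute_act_mode_zero_nullOperator (hV : IsSmooth V) (hk : HasLevel V 1) (Y : sl2)
    (κ τ : ℂ) : Commute (act V (mode Y 0)) (nullOperator hV X κ τ) := by
  have hL (n : ℤ) := commute_act_mode_zero_sugawara hX hV hk (by norm_num [dualCoxeter]) Y n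
  rw [nullOperator, sum_act_mode_sq]
  exact (((hL _).smul_right _).add_right (((hL _).pow_right 2).smul_right _)).add_right
    (((commute_mode_zero_casimirMode hX Y _ _).map (Algebra.lsmul ℂ ℂ V)).smul_right _)

theorem IsSingular.nullOperator_apply_eq_zero (hV : IsSmooth V) (hk : HasLevel V 1) {v : V}
    (hv : IsSingular 1 v) (hE : mode E (-1) • v = 0) (hFF : mode F 0 • mode F 0 • v = 0) {κ τ : ℂ}
    (hκτ : κ + 2 * τ - 4 = 0) : nullOperator hV X κ τ v = 0 := by
  rw [nullOperator_apply, hv.sugawara_neg_two_apply hX hV hk hE hFF,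
    hv.sugawara_neg_one_sq_apply hX hV hk hE]
  generalize casimirMode X (-1) (-1) • v = w
  linear_combination (norm := module) ((1 / 4 : ℂ) * hκτ) • w

end NullOperator

section Top

variable {M : Type*} [AddCommGroup M] [Module ℂ M] [LieRingModule sl2 M] {k : ℂ}

theorem smul_top (N : Submodule U (Induced M k)) (u : U) (m : M) :
    u • top N m = N.mkQ (proj M k (u ⊗ₜ m)) := by
  rw [top, ← map_smul, ← map_smul, TensorProduct.smul_tmul', smul_eq_mul, mul_one]

theorem mode_zero_smul_top (N : Submodule U (Induced M k)) (Y : sl2) (m : M) :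
    mode Y 0 • top N m = top N ⁅Y, m⁆ := by
  have hrel : mode Y 0 ⊗ₜ[ℂ] m - (1 : U) ⊗ₜ[ℂ] ⁅Y, m⁆ ∈ inducedRel M k :=
    Submodule.subset_span (Or.inl (Or.inl ⟨Y, m, rfl⟩))
  rw [smul_top, top, sub_eq_zero.1 ((map_sub _ _ _).symm.trans (proj_eq_zero M hrel))]

theorem mode_pos_smul_top (N : Submodule U (Induced M k)) (Y : sl2) (m : M) {n : ℤ} (hn : 0 < n) :
    mode Y n • top N m = 0 := by
  have hrel : mode Y n ⊗ₜ[ℂ] m ∈ inducedRel M k :=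
    Submodule.subset_span (Or.inl (Or.inr ⟨Y, n, m, hn, rfl⟩))
  rw [smul_top, proj_eq_zero M hrel, map_zero]

theorem isSingular_top (N : Submodule U (Induced M k)) {lam : ℂ} {m : M} (hE : ⁅E, m⁆ = 0)
    (hH : ⁅H, m⁆ = lam • m) : IsSingular lam (top N m) where
  mode_pos_smul _ hn Y := mode_pos_smul_top N Y m hn
  E_smul := by rw [mode_zero_smul_top, hE, top, TensorProduct.tmul_zero, map_zero, map_zero]
  H_smul := by
    rw [mode_zero_smul_top, hH, top, TensorProduct.tmul_smul]
    rfl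

theorem modeK_smul_top (N : Submodule U (Induced M k)) (m : M) :
    modeK • top N m = k • top N m := by
  have hrel : modeK ⊗ₜ[ℂ] m - (1 : U) ⊗ₜ[ℂ] (k • m) ∈ inducedRel M k :=
    Submodule.subset_span (Or.inr ⟨m, rfl⟩)
  rw [smul_top, sub_eq_zero.1 ((map_sub _ _ _).symm.trans (proj_eq_zero M hrel)),
    TensorProduct.tmul_smul]
  rfl

theorem mul_modeK (u : U) : u * modeK = modeK * u := by
  let C : Subalgebra ℂ U := Subalgebra.centralizer ℂ {modeK}
  have hmem {u : U} : u ∈ C ↔ modeK * u = u * modeK := by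
    simp only [C, Subalgebra.mem_centralizer_iff, Set.mem_singleton_iff, forall_eq]
  have hC : u • (1 : U) ∈ C.toSubmodule :=
    smul_mem_of_mode_smul_mem (P := C.toSubmodule)
      (fun Y n _ hw => C.mul_mem (hmem.2 (mode_mul_modeK Y n).symm) hw)
      (fun _ hw => C.mul_mem (hmem.2 rfl) hw) u 1 C.one_mem
  rw [smul_eq_mul, mul_one] at hC
  exact (hmem.1 hC).symm

theorem hasLevel_quotient (N : Submodule U (Induced M k)) : HasLevel (Induced M k ⧸ N) k := by
  intro w
  obtain ⟨w, rfl⟩ := N.mkQ_surjective w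
  obtain ⟨w, rfl⟩ := proj_surjective M k w
  induction w using TensorProduct.induction_on with
  | zero => rw [map_zero, map_zero, smul_zero, smul_zero]
  | add x y hx hy => rw [map_add, map_add, smul_add, smul_add, hx, hy]
  | tmul u m => rw [← smul_top, ← mul_smul, ← mul_modeK, mul_smul, modeK_smul_top, smul_comm]

end Top

end

end AffineSl2

open AffineSl2 in
theorem mainTheorem7_general {V : Type*} [AddCommGroup V] [Module ℂ V] [Module U V]
    [IsScalarTower ℂ U V] [IsSimpleModule U V] (hV : IsSmooth V) (hk : HasLevel V 1)
    {X : Module.Basis (Fin 3) ℂ sl2} (hX : ∀ r s, form (X r) (X s) = if r = s then 1 else 0)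
    {v : V} (hv : IsSingular 1 v) {κ τ : ℂ} (hκτ : κ + 2 * τ - 4 = 0) :
    ∀ w ∈ ({v, mode F 0 • v} : Set V), nullOperator hV X κ τ w = 0 := by
  have hk0 : (1 : ℂ) + dualCoxeter ≠ 0 := by norm_num [dualCoxeter]
  have hv0 : nullOperator hV X κ τ v = 0 :=
    hv.nullOperator_apply_eq_zero hX hV hk (hv.E_neg_one_smul_eq_zero hX hV hk hk0)
      (hv.F_smul_F_smul_eq_zero hX hV hk hk0) hκτ
  rintro w (rfl | rfl)
  · exact hv0
  · have hcomm := LinearMap.congr_fun (commute_act_mode_zero_nullOperator hX hV hk F κ τ) v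
    exact hcomm.symm.trans (by rw [Module.End.mul_apply, hv0, map_zero])

theorem mainTheorem7
    -- the fundamental representation of `sl₂`, with a highest weight vector `v`
    {M : Type*} [AddCommGroup M] [Module ℂ M] [LieRingModule AffineSl2.sl2 M]
    [LieModule ℂ AffineSl2.sl2 M] [FiniteDimensional ℂ M]
    [LieModule.IsIrreducible ℂ AffineSl2.sl2 M]
    (v : M) (hv : v ≠ 0) (hE : ⁅AffineSl2.E, v⁆ = 0) (hH : ⁅AffineSl2.H, v⁆ = v)
    -- the irreducible quotient of the induced representation of level one
    (N : Submodule AffineSl2.U (AffineSl2.Induced M 1))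
    [IsSimpleModule AffineSl2.U (AffineSl2.Induced M 1 ⧸ N)]
    -- an orthonormal basis of `sl₂`
    (X : Module.Basis (Fin 3) ℂ AffineSl2.sl2)
    (hX : ∀ r s, AffineSl2.form (X r) (X s) = if r = s then 1 else 0)
    (κ τ : ℂ) (hκτ : κ + 2 * τ - 4 = 0) :
    ∀ w ∈ ({v, ⁅AffineSl2.F, v⁆} : Set M),
      ((-2 : ℂ) • AffineSl2.virasoro N X (-2) + (κ / 2) • AffineSl2.virasoro N X (-1) ^ 2 +
        (τ / 2) • ∑ r, AffineSl2.act (AffineSl2.Induced M 1 ⧸ N) (AffineSl2.mode (X r) (-1)) ^ 2)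
        (AffineSl2.top N w) = 0 := by
  have hzero := mainTheorem7_general (AffineSl2.isSmooth_quotient N)
    (AffineSl2.hasLevel_quotient N) hX
    (AffineSl2.isSingular_top N hE (hH.trans (one_smul ℂ v).symm)) hκτ
  rintro w (rfl | rfl)
  · exact hzero _ (Or.inl rfl)
  · exact hzero _ (Or.inr (AffineSl2.mode_zero_smul_top N AffineSl2.F v).symm)
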